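/- Let $k\ge 3$ be an integer and let $q\ge 2$ be an even integer. Let $L(k,q)$ be the rectangular hexagon lattice in the plane: its vertices are the points $v_{i,j}=(i,j)$ with integers $0\le i\le k$, $0\le j\le q$, and its edges are the horizontal segments $v_{i,j}v_{i+1,j}$ ($0\le i\le k-1$, $0\le j\le q$) and the vertical segments $v_{i,j}v_{i,j+1}$ ($0\le i\le k$, $0\le j\le q-1$, $i\equiv j \pmod 2$). Let $K_o(k,q)$ be the graph obtained from $L(k,q)$ by first identifying $v_{i,0}$ with $v_{i,q}$ for all $i$, and then identifying $v_{0,j}$ with $v_{k,q-1-j}$ for all $j$ if $k$ is even, and $v_{0,j}$ with $v_{k,q-2-j}$ for all $j$ if $k$ is odd (second indices being read modulo $q$). It is embedded in the closed surface whose faces are the hexagons of the lattice, that is, the discs bounded by the images of the cycles through $(i,j),(i+1,j),(i+2,j),(i+2,j+1),(i+1,j+1),(i,j+1)$ with $0\le i<k$, $0\le j<q$, $i\equiv j\pmod 2$, where a point $(k+a,j)$ with $a\ge 0$ stands for $v_{a,q-1-j}$ ($k$ even) or $v_{a,q-2-j}$ ($k$ odd). A cycle of a graph embedded in a surface is called one-sided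 if its tubular neighbourhood is a Möbius strip (that is, if the cycle does not disconnect its tubular neighbourhood), and separating if its complement in the surface is disconnected. An embedding of a graph in the Klein bottle is called cross-cap-odd if every non-separating cycle of the graph has odd length if and only if it is one-sided. Then the surface above is the Klein bottle, and the embedding of $K_o(k,q)$ in it is cross-cap-odd: every cycle of $K_o(k,q)$ that does not separate the Klein bottle has odd length if and only if it is one-sided. -/

import Mathlib

/-! ### Graphs embedded in closed surfaces, given by their facial cycles

A strong 2-cell embedding of a graph `G` in a closed surface is the same thing as a family of
cycles of `G`, one for each face, such that gluing a disc to `G` along each of these cycles yields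
a surface. The family is recorded as `bd : F → Set (Sym2 V)`, where `F` is the set of faces and
`bd f` is the set of edges on the boundary of the face `f`. -/

namespace SurfaceMap

variable {V F : Type*}

/-- The closed walk `w` runs once around the boundary of the face `f`, which is a cycle. -/
def Bounds (G : SimpleGraph V) (bd : F → Set (Sym2 V)) (f : F) {v : V} (w : G.Walk v v) : Prop :=
  w.IsCycle ∧ ∀ e, e ∈ w.edges ↔ e ∈ bd f

/-- The vertex `v` lies on the boundary of the face `f`. -/
def Touches (bd : F → Set (Sym2 V)) (v : V) (f : F) : Prop :=
  ∃ e ∈ bd f, v ∈ e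

/-- The link of the vertex `v`: its vertices are the edges of `G` at `v`, and two of them are
adjacent if they form a corner of a face at `v`. -/
def link (G : SimpleGraph V) (bd : F → Set (Sym2 V)) (v : V) :
    SimpleGraph {e : Sym2 V // e ∈ G.edgeSet ∧ v ∈ e} :=
  SimpleGraph.fromRel fun e e' => ∃ f, e.1 ∈ bd f ∧ e'.1 ∈ bd f

/-- The discs glued to the connected finite graph `G` along the sets `bd f` form a closed connected
surface in which `G` is strongly embedded: every face is bounded by a cycle, every edge lies
on exactly two faces, and the faces around a vertex form one cyclic sequence (as every edge lies
on two faces, each link is a disjoint union of cycles, so that this says that it is connected). -/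
structure IsStrongEmbedding (G : SimpleGraph V) (bd : F → Set (Sym2 V)) : Prop where
  finite_vert : Finite V
  finite_face : Finite F
  connected : G.Connected
  facial : ∀ f, ∃ (v : V) (w : G.Walk v v), Bounds G bd f w
  two_faces : ∀ e ∈ G.edgeSet, {f | e ∈ bd f}.ncard = 2
  link_connected : ∀ v, (link G bd v).Connected

/-- The surface is orientable: the facial cycles can be directed in such a way that no edge is
traversed in the same direction by two different faces. -/
def Orientable (G : SimpleGraph V) (bd : F → Set (Sym2 V)) : Prop :=
  ∃ (b : F → V) (w : ∀ f, G.Walk (b f) (b f)), (∀ f, Bounds G bd f (w f)) ∧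
    ∀ f f', f ≠ f' → ∀ d ∈ (w f).darts, d ∉ (w f').darts

/-- The Euler characteristic of the surface. -/
noncomputable def eulerChar (G : SimpleGraph V) (F : Type*) : ℤ :=
  (Nat.card V : ℤ) - Nat.card G.edgeSet + Nat.card F

/-- `G` is strongly embedded in the Klein bottle, the closed connected non-orientable surface of
Euler characteristic `0`. -/
structure IsKleinBottleEmbedding (G : SimpleGraph V) (bd : F → Set (Sym2 V)) : Prop where
  strong : IsStrongEmbedding G bd
  nonorientable : ¬ Orientable G bd
  euler : eulerChar G F = 0

/-- The complement in the surface of the edges in `C` and their ends, as a graph on the faces: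
one passes from a face to another one across an edge that is not in `C`. -/
def complementGraph (bd : F → Set (Sym2 V)) (C : Set (Sym2 V)) : SimpleGraph F :=
  SimpleGraph.fromRel fun f f' => ∃ e, e ∉ C ∧ e ∈ bd f ∧ e ∈ bd f'

/-- The cycle with edge set `C` separates the surface: its complement is not connected. -/
def Separates (bd : F → Set (Sym2 V)) (C : Set (Sym2 V)) : Prop :=
  ¬ (complementGraph bd C).Connected

/-- What remains of a tubular neighbourhood of the cycle with edge set `C` when the cycle itself
is removed. It consists of the corners `(v, f)`, where `v` is a vertex of the cycle and `f` is
a face at `v`. Two corners at the same vertex `v` are glued along an edge at `v` that does not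
belong to the cycle; two corners of the same face `f` at the two ends of an edge of the cycle on
the boundary of `f` are joined along the `f`-side of this edge. -/
def sideGraph (bd : F → Set (Sym2 V)) (C : Set (Sym2 V)) :
    SimpleGraph {c : V × F // (∃ e ∈ C, c.1 ∈ e) ∧ Touches bd c.1 c.2} :=
  SimpleGraph.fromRel fun c c' =>
    (c.1.1 = c'.1.1 ∧ ∃ e, e ∉ C ∧ c.1.1 ∈ e ∧ e ∈ bd c.1.2 ∧ e ∈ bd c'.1.2) ∨
    (c.1.2 = c'.1.2 ∧ s(c.1.1, c'.1.1) ∈ C ∧ s(c.1.1, c'.1.1) ∈ bd c.1.2)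

/-- The cycle with edge set `C` is one-sided. Its tubular neighbourhood is a bundle of intervals
over a circle, hence an annulus, which the central circle cuts into two parts, or a Möbius strip,
which the central circle does not disconnect; the cycle is one-sided in the second case. -/
def OneSided (bd : F → Set (Sym2 V)) (C : Set (Sym2 V)) : Prop :=
  (sideGraph bd C).Connected

/-- `G` is embedded in the Klein bottle, and a cycle of `G` that does not separate the surface is
odd if and only if it is one-sided. -/
def IsCrossCapOdd (G : SimpleGraph V) (bd : F → Set (Sym2 V)) : Prop :=
  IsKleinBottleEmbedding G bd ∧
    ∀ (v : V) (w : G.Walk v v), w.IsCycle → ¬ Separates bd {e | e ∈ w.edges} →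
      (Odd w.length ↔ OneSided bd {e | e ∈ w.edges})

end SurfaceMap

/-! ### The polyhex `K_o(k, q)` -/

namespace Ko

/-- The edges of the rectangular hexagon lattice `L(k, q)`, whose vertices are the points `(i, j)`
with `0 ≤ i ≤ k` and `0 ≤ j ≤ q`, each edge directed to the right or upwards. -/
def LatticeEdge (k q : ℕ) (p r : ℕ × ℕ) : Prop :=
  (p.1 + 1 ≤ k ∧ p.2 ≤ q ∧ r = (p.1 + 1, p.2)) ∨
  (p.1 ≤ k ∧ p.2 + 1 ≤ q ∧ p.1 % 2 = p.2 % 2 ∧ r = (p.1, p.2 + 1))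

/-- The vertices of `K_o(k, q)`: each of them is `v_{i,j}` for exactly one `i` with `0 ≤ i < k`
and one `j` modulo `q`. -/
abbrev Vert (k q : ℕ) : Type := ZMod k × ZMod q

/-- The vertex of `K_o(k, q)` that the point `(i, j)` becomes. As `v_{i,0} = v_{i,q}`, the second
coordinate counts modulo `q`; the point `(k, j)` becomes `v_{0,q-1-j}` if `k` is even and
`v_{0,q-2-j}` if `k` is odd. For `k < i < 2 * k` this continues the lattice across the
line along which the two ends are glued: `(k + a, j)` is identified with `(a, q-1-j)` or
`(a, q-2-j)`. -/
def pt (k q : ℕ) (p : ℕ × ℕ) : Vert k q :=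
  if p.1 < k then ((p.1 : ZMod k), (p.2 : ZMod q))
  else if Even k then (((p.1 - k : ℕ) : ZMod k), (q : ZMod q) - 1 - (p.2 : ZMod q))
  else (((p.1 - k : ℕ) : ZMod k), (q : ZMod q) - 2 - (p.2 : ZMod q))

/-- The graph `K_o(k, q)`: the lattice `L(k, q)` after the identifications. -/
def graph (k q : ℕ) : SimpleGraph (Vert k q) :=
  SimpleGraph.fromRel fun u v => ∃ p r, LatticeEdge k q p r ∧ pt k q p = u ∧ pt k q r = v

/-- The hexagonal faces, indexed by their lower left corners `(i, j)`, where `i ≡ j` modulo `2`. -/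
abbrev Face (k q : ℕ) : Type := {p : ℕ × ℕ // p.1 < k ∧ p.2 < q ∧ p.1 % 2 = p.2 % 2}

/-- The boundary of the hexagon with corners `(i, j)`, `(i + 1, j)`, `(i + 2, j)`,
`(i + 2, j + 1)`, `(i + 1, j + 1)`, `(i, j + 1)`. -/
def faceBd (k q : ℕ) (f : Face k q) : Set (Sym2 (Vert k q)) :=
  let x : ℕ → ℕ → Vert k q := fun a b => pt k q (f.1.1 + a, f.1.2 + b)
  {s(x 0 0, x 1 0), s(x 1 0, x 2 0), s(x 2 0, x 2 1),
    s(x 2 1, x 1 1), s(x 1 1, x 0 1), s(x 0 1, x 0 0)}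

end Ko

/-! The edges along each hexagon of the plane lattice are alternately positive and negative, where
the lower left edge is positive. The glide reflection respects this, so that it makes sense on the
surface, and each edge is positive for exactly one of its two faces. The faces at a vertex can hence
be directed coherently by letting each of them leave the vertex along its positive edge, and this
local orientation is reversed along every edge. So a cycle is one-sided if and only if it is odd,
and an orientation of the whole surface would be a 2-colouring of the graph. There is none, as the
glide reflection exchanges the colour classes of the plane lattice. -/

/-! ### Cycles of a graph and the alternating edges along them -/

namespace SurfaceMap

variable {V F : Type*} {G : SimpleGraph V} {bd pos : F → Set (Sym2 V)}

section EmbeddedCycle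

variable {n : ℕ} {c : ZMod n → V}

/-- The edges `c t c (t + 1)` of a closed polygon whose vertices `c t` are indexed cyclically. -/
def cycleEdges (c : ZMod n → V) : Set (Sym2 V) :=
  Set.range fun t => s(c t, c (t + 1))

/-- Every second edge of a closed polygon, starting with `c 0 c 1`. This is meant for even `n`. -/
def alternateEdges (c : ZMod n → V) : Set (Sym2 V) :=
  Set.range fun t => s(c (2 * t), c (2 * t + 1))

/-- A cycle of `G`, given by its vertices `c t` in their cyclic order. -/
structure IsEmbeddedCycle (G : SimpleGraph V) (c : ZMod n → V) : Prop where
  three_le : 3 ≤ n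
  injective : Function.Injective c
  adj : ∀ t, G.Adj (c t) (c (t + 1))

theorem cycleEdges_comp_sub (c : ZMod n → V) (r : ZMod n) :
    cycleEdges (fun t => c (r - t)) = cycleEdges c := by
  have reflect (t : ZMod n) : s(c (r - t), c (r - (t + 1))) =
      (fun t => s(c t, c (t + 1))) (Equiv.subLeft (r - 1) t) := by
    rw [Sym2.eq_swap]
    simp only [Equiv.subLeft_apply]
    ring_nf
  simp only [cycleEdges, reflect]
  exact (Equiv.subLeft (r - 1)).surjective.range_comp fun t => s(c t, c (t + 1))

theorem alternateEdges_comp_sub (c : ZMod n → V) (r : ZMod n) :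
    alternateEdges (fun t => c (2 * r + 1 - t)) = alternateEdges c := by
  have reflect (t : ZMod n) : s(c (2 * r + 1 - 2 * t), c (2 * r + 1 - (2 * t + 1))) =
      (fun t => s(c (2 * t), c (2 * t + 1))) (Equiv.subLeft r t) := by
    rw [Sym2.eq_swap]
    simp only [Equiv.subLeft_apply]
    ring_nf
  simp only [alternateEdges, reflect]
  exact (Equiv.subLeft r).surjective.range_comp fun t => s(c (2 * t), c (2 * t + 1))

theorem mk_mem_cycleEdges_iff (hc : Function.Injective c) {t : ZMod n} {u : V} :
    s(c t, u) ∈ cycleEdges c ↔ u = c (t + 1) ∨ u = c (t - 1) := by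
  constructor
  · rintro ⟨r, hr⟩
    rcases Sym2.eq_iff.1 hr with ⟨h₁, h₂⟩ | ⟨h₁, h₂⟩
    · exact .inl (by rw [← h₂, hc h₁])
    · exact .inr (by rw [← h₁, ← hc h₂, add_sub_cancel_right])
  · rintro (rfl | rfl)
    · exact ⟨t, rfl⟩
    · exact ⟨t - 1, by simp only [sub_add_cancel, Sym2.eq_swap]⟩

theorem mk_mem_alternateEdges_iff (hn : Even n) (hc : Function.Injective c) {t : ZMod n} {u : V} :
    s(c (2 * t), u) ∈ alternateEdges c ↔ u = c (2 * t + 1) := by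
  refine ⟨?_, fun h => ⟨t, by rw [h]⟩⟩
  rintro ⟨r, hr⟩
  rcases Sym2.eq_iff.1 hr with ⟨h₁, h₂⟩ | ⟨-, h₂⟩
  · rw [← h₂, hc h₁]
  · have parity := congrArg (ZMod.castHom hn.two_dvd (ZMod 2)) (hc h₂)
    rw [map_add, map_mul, map_mul, map_one, map_ofNat, CharTwo.two_eq_zero (R := ZMod 2), zero_mul,
      zero_mul, zero_add] at parity
    exact absurd parity one_ne_zero

theorem exists_eq_of_mem_cycleEdges {e : Sym2 V} {v : V} (he : e ∈ cycleEdges c) (hv : v ∈ e) :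
    ∃ t, c t = v := by
  obtain ⟨t, rfl⟩ := he
  rcases Sym2.mem_iff.1 hv with rfl | rfl <;> exact ⟨_, rfl⟩

namespace IsEmbeddedCycle

theorem adj_sub_one (h : IsEmbeddedCycle G c) (t : ZMod n) : G.Adj (c t) (c (t - 1)) := by
  simpa only [sub_add_cancel] using (h.adj (t - 1)).symm

theorem add_one_ne_sub_one (h : IsEmbeddedCycle G c) (t : ZMod n) : c (t + 1) ≠ c (t - 1) := by
  intro heq
  have two_eq : ((2 : ℕ) : ZMod n) = 0 := by
    push_cast
    linear_combination h.injective heq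
  have := Nat.le_of_dvd two_pos ((ZMod.natCast_eq_zero_iff 2 n).1 two_eq)
  have := h.three_le
  omega

theorem exists_isCycle_getVert_eq (h : IsEmbeddedCycle G c) :
    ∃ w : G.Walk (c 0) (c 0), w.IsCycle ∧ w.length = n ∧ ∀ i ≤ n, w.getVert i = c (-i) := by
  obtain ⟨m, rfl⟩ := Nat.exists_eq_add_of_le' h.three_le
  have hom_adj {s t : Fin (m + 3)} (hst : (SimpleGraph.cycleGraph (m + 3)).Adj s t) :
      G.Adj (c s) (c t) := by
    rcases SimpleGraph.cycleGraph_adj.1 hst with h₁ | h₁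
    · rw [sub_eq_iff_eq_add'.1 h₁]
      exact (h.adj t).symm
    · rw [sub_eq_iff_eq_add'.1 h₁]
      exact h.adj s
  let φ : SimpleGraph.cycleGraph (m + 3) →g G := ⟨c, hom_adj⟩
  refine ⟨(SimpleGraph.cycleGraph.cycle m).map φ,
    SimpleGraph.Walk.IsCycle.map h.injective SimpleGraph.cycleGraph.isCycle_cycle, ?_, ?_⟩
  · rw [SimpleGraph.Walk.length_map, SimpleGraph.cycleGraph.length_cycle]
  · intro i hi
    have index_eq : (m + 3 - i) % (m + 3) = (-i : ZMod (m + 3)).val := by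
      rw [← ZMod.val_natCast, Nat.cast_sub hi, ZMod.natCast_self, zero_sub]
    rw [SimpleGraph.Walk.getVert_map, SimpleGraph.cycleGraph.getVert_cycle hi]
    exact congrArg c (ZMod.val_injective (m + 3) index_eq)

theorem exists_isCycle_edges_eq (h : IsEmbeddedCycle G c) :
    ∃ w : G.Walk (c 0) (c 0), w.IsCycle ∧ ∀ e, e ∈ w.edges ↔ e ∈ cycleEdges c := by
  have : NeZero n := ⟨by have := h.three_le; omega⟩
  obtain ⟨w, hw, hlen, getVert_w⟩ := h.exists_isCycle_getVert_eq
  refine ⟨w, hw, Sym2.ind fun u v => ?_⟩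
  rw [SimpleGraph.Walk.mk_mem_edges_iff_exists, hlen]
  constructor
  · rintro ⟨i, hi, he⟩
    refine ⟨-(i + 1), ?_⟩
    rw [← he, getVert_w i hi.le, getVert_w (i + 1) hi, Sym2.eq_swap]
    simp
  · rintro ⟨t, ht⟩
    have hlt := ZMod.val_lt (-(t + 1))
    refine ⟨(-(t + 1)).val, hlt, ?_⟩
    rw [← ht, getVert_w _ hlt.le, getVert_w _ hlt, Sym2.eq_swap]
    simp

end IsEmbeddedCycle

theorem exists_isEmbeddedCycle {v : V} {w : G.Walk v v} (hw : w.IsCycle) :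
    ∃ c : ZMod w.length → V, IsEmbeddedCycle G c ∧
      ∀ d, d ∈ w.darts ↔ ∃ t, d.toProd = (c t, c (t + 1)) := by
  have hlen := hw.three_le_length
  have : NeZero w.length := ⟨by omega⟩
  have : Fact (1 < w.length) := ⟨by omega⟩
  have getVert_succ (t : ZMod w.length) : w.getVert (t + 1).val = w.getVert (t.val + 1) := by
    have := ZMod.val_lt t
    rw [ZMod.val_add, ZMod.val_one]
    by_cases h : t.val + 1 = w.length
    · rw [h, Nat.mod_self, w.getVert_zero, w.getVert_length]
    · rw [Nat.mod_eq_of_lt (by omega)]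
  refine ⟨fun t => w.getVert t.val, ⟨hlen, fun s t hst => ?_, fun t => ?_⟩, fun d => ?_⟩
  · have hs := ZMod.val_lt s
    have ht := ZMod.val_lt t
    exact ZMod.val_injective _ (hw.getVert_injOn' (by simp; omega) (by simp; omega) hst)
  · simpa only [getVert_succ] using w.adj_getVert_succ (ZMod.val_lt t)
  · simp only [getVert_succ, List.mem_iff_getElem, SimpleGraph.Walk.darts_getElem_eq_getVert]
    constructor
    · rintro ⟨i, hi, rfl⟩
      rw [SimpleGraph.Walk.length_darts] at hi
      exact ⟨i, by rw [ZMod.val_natCast, Nat.mod_eq_of_lt hi]⟩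
    · rintro ⟨t, ht⟩
      exact ⟨t.val, by simpa only [SimpleGraph.Walk.length_darts] using ZMod.val_lt t,
        SimpleGraph.Dart.ext _ _ ht.symm⟩

theorem edges_eq_cycleEdges {v : V} {w : G.Walk v v} (hc : IsEmbeddedCycle G c)
    (hd : ∀ d, d ∈ w.darts ↔ ∃ t, d.toProd = (c t, c (t + 1))) :
    {e | e ∈ w.edges} = cycleEdges c := by
  ext e
  simp only [Set.mem_ofPred_eq, SimpleGraph.Walk.edges, List.mem_map, hd]
  constructor
  · rintro ⟨d, ⟨t, ht⟩, rfl⟩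
    exact ⟨t, by rw [SimpleGraph.Dart.edge, ht]⟩
  · rintro ⟨t, rfl⟩
    exact ⟨⟨(c t, c (t + 1)), hc.adj t⟩, ⟨t, rfl⟩, rfl⟩

end EmbeddedCycle

/-! ### Cubic maps with alternately signed facial cycles -/

/-- The vertex `v` of a cubic map has the neighbours `nb l` and the faces `fc m`, where `fc m` is
the face opposite to the edge to `nb m`. The sets `pos f` single out one of the two edges of each
face at `v` and one of the two faces of each edge at `v`. -/
structure AlternatingAt (G : SimpleGraph V) (bd pos : F → Set (Sym2 V)) (v : V)
    (nb : Fin 3 → V) (fc : Fin 3 → F) : Prop where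
  nb_injective : Function.Injective nb
  adj_iff : ∀ u, G.Adj v u ↔ ∃ l, u = nb l
  exists_eq_of_touches : ∀ f, Touches bd v f → ∃ m, f = fc m
  mem_bd_iff : ∀ l m, s(v, nb l) ∈ bd (fc m) ↔ l ≠ m
  mem_pos_iff : ∀ l m, s(v, nb l) ∈ pos (fc m) ↔ l = m + 1

/-- A cubic map in which the edges along every face `f` alternately belong and do not belong to
`pos f`, in such a way that every edge belongs to `pos f` for exactly one of its two faces. -/
structure IsAlternating (G : SimpleGraph V) (bd pos : F → Set (Sym2 V)) : Prop where
  subset_edgeSet : ∀ f, bd f ⊆ G.edgeSet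
  exists_alternatingAt : ∀ v, ∃ nb fc, AlternatingAt G bd pos v nb fc

theorem touches_of_mem {v u : V} {f : F} (hf : s(v, u) ∈ bd f) : Touches bd v f :=
  ⟨_, hf, Sym2.mem_mk_left v u⟩

namespace IsAlternating

theorem mem_pos_iff_notMem_of_face_ne (h : IsAlternating G bd pos) {v u : V} {f f' : F}
    (hf : s(v, u) ∈ bd f) (hf' : s(v, u) ∈ bd f') (hne : f ≠ f') :
    s(v, u) ∈ pos f ↔ s(v, u) ∉ pos f' := by
  obtain ⟨nb, fc, H⟩ := h.exists_alternatingAt v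
  obtain ⟨l, rfl⟩ := (H.adj_iff u).1 (h.subset_edgeSet f hf)
  obtain ⟨m, rfl⟩ := H.exists_eq_of_touches f (touches_of_mem hf)
  obtain ⟨m', rfl⟩ := H.exists_eq_of_touches f' (touches_of_mem hf')
  rw [H.mem_bd_iff] at hf hf'
  replace hne : m ≠ m' := ne_of_apply_ne fc hne
  rw [H.mem_pos_iff, H.mem_pos_iff]
  clear H
  decide +revert

theorem mem_pos_iff_notMem_of_edge_ne (h : IsAlternating G bd pos) {v u u' : V} {f : F}
    (hu : s(v, u) ∈ bd f) (hu' : s(v, u') ∈ bd f) (hne : u ≠ u') :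
    s(v, u) ∈ pos f ↔ s(v, u') ∉ pos f := by
  obtain ⟨nb, fc, H⟩ := h.exists_alternatingAt v
  obtain ⟨l, rfl⟩ := (H.adj_iff u).1 (h.subset_edgeSet f hu)
  obtain ⟨l', rfl⟩ := (H.adj_iff u').1 (h.subset_edgeSet f hu')
  obtain ⟨m, rfl⟩ := H.exists_eq_of_touches f (touches_of_mem hu)
  rw [H.mem_bd_iff] at hu hu'
  replace hne : l ≠ l' := ne_of_apply_ne nb hne
  rw [H.mem_pos_iff, H.mem_pos_iff]
  clear H
  decide +revert

theorem exists_face_mem_pos_iff (h : IsAlternating G bd pos) {v u : V} (hu : G.Adj v u) (p : Prop) :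
    ∃ f, s(v, u) ∈ bd f ∧ (s(v, u) ∈ pos f ↔ p) := by
  obtain ⟨nb, fc, H⟩ := h.exists_alternatingAt v
  obtain ⟨l, rfl⟩ := (H.adj_iff u).1 hu
  have exists_index (l : Fin 3) : (∃ m, l ≠ m ∧ l = m + 1) ∧ ∃ m, l ≠ m ∧ l ≠ m + 1 := by
    decide +revert
  obtain ⟨⟨m, hm, hpos⟩, ⟨m', hm', hneg⟩⟩ := exists_index l
  by_cases hp : p
  · exact ⟨fc m, (H.mem_bd_iff _ _).2 hm, (H.mem_pos_iff _ _).trans (iff_of_true hpos hp)⟩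
  · exact ⟨fc m', (H.mem_bd_iff _ _).2 hm', (H.mem_pos_iff _ _).trans (iff_of_false hneg hp)⟩

theorem exists_common_face (h : IsAlternating G bd pos) {v u u' : V} (hu : G.Adj v u)
    (hu' : G.Adj v u') : ∃ f, s(v, u) ∈ bd f ∧ s(v, u') ∈ bd f := by
  obtain ⟨nb, fc, H⟩ := h.exists_alternatingAt v
  obtain ⟨l, rfl⟩ := (H.adj_iff u).1 hu
  obtain ⟨l', rfl⟩ := (H.adj_iff u').1 hu'
  have exists_index (l l' : Fin 3) : ∃ m, l ≠ m ∧ l' ≠ m := by decide +revert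
  obtain ⟨m, hm, hm'⟩ := exists_index l l'
  exact ⟨fc m, (H.mem_bd_iff _ _).2 hm, (H.mem_bd_iff _ _).2 hm'⟩

theorem ncard_faces_eq_two (h : IsAlternating G bd pos) (e : Sym2 V) (he : e ∈ G.edgeSet) :
    {f | e ∈ bd f}.ncard = 2 := by
  induction e with | _ v u
  obtain ⟨f, hf, hpos⟩ := h.exists_face_mem_pos_iff he True
  obtain ⟨g, hg, hneg⟩ := h.exists_face_mem_pos_iff he False
  refine Set.ncard_eq_two.2 ⟨f, g, ?_, Set.ext fun x => ⟨fun hx => ?_, ?_⟩⟩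
  · rintro rfl
    tauto
  · by_contra hne
    rw [Set.mem_insert_iff, Set.mem_singleton_iff, not_or] at hne
    have := h.mem_pos_iff_notMem_of_face_ne hx hf hne.1
    have := h.mem_pos_iff_notMem_of_face_ne hx hg hne.2
    tauto
  · rintro (rfl | rfl) <;> assumption

theorem link_connected (h : IsAlternating G bd pos) (v : V) : (link G bd v).Connected := by
  obtain ⟨nb, fc, H⟩ := h.exists_alternatingAt v
  have : Nonempty {e : Sym2 V // e ∈ G.edgeSet ∧ v ∈ e} :=
    ⟨⟨s(v, nb 0), (H.adj_iff _).2 ⟨0, rfl⟩, Sym2.mem_mk_left _ _⟩⟩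
  refine ⟨?_⟩
  rintro ⟨e, he, u, rfl⟩ ⟨e', he', u', rfl⟩
  obtain ⟨f, hf, hf'⟩ := h.exists_common_face he he'
  by_cases hne : s(v, u) = s(v, u')
  · simp only [hne, SimpleGraph.Reachable.refl]
  · exact SimpleGraph.Adj.reachable ⟨fun heq => hne (congrArg Subtype.val heq), .inl ⟨f, hf, hf'⟩⟩

theorem two_mul_card_edgeSet [Finite V] (h : IsAlternating G bd pos) :
    2 * Nat.card G.edgeSet = 3 * Nat.card V := by
  classical
  have := Fintype.ofFinite V
  have degree_eq (v : V) : G.degree v = 3 := by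
    obtain ⟨nb, fc, H⟩ := h.exists_alternatingAt v
    have neighbors_eq : G.neighborFinset v = Finset.univ.image nb := by
      ext u
      simp only [SimpleGraph.mem_neighborFinset, H.adj_iff, Finset.mem_image, Finset.mem_univ,
        true_and, eq_comm]
    rw [← SimpleGraph.card_neighborFinset_eq_degree, neighbors_eq,
      Finset.card_image_of_injective _ H.nb_injective, Finset.card_univ, Fintype.card_fin]
  have sum_degrees := G.sum_degrees_eq_twice_card_edges
  simp only [degree_eq, Finset.sum_const, Finset.card_univ, smul_eq_mul] at sum_degrees
  rw [Nat.card_eq_fintype_card, Nat.card_eq_fintype_card, ← SimpleGraph.edgeFinset_card,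
    ← sum_degrees, mul_comm]

end IsAlternating

/-! ### Orientations -/

/-- The walk `w` passes from `v` to its neighbour `u`. -/
def Traverses {b : V} (w : G.Walk b b) (v u : V) : Prop :=
  ∃ h : G.Adj v u, ⟨(v, u), h⟩ ∈ w.darts

theorem traverses_iff {b : V} {w : G.Walk b b} {n : ℕ} {c : ZMod n → V}
    (hc : IsEmbeddedCycle G c) (hd : ∀ d, d ∈ w.darts ↔ ∃ t, d.toProd = (c t, c (t + 1)))
    (t : ZMod n) (u : V) : Traverses w (c t) u ↔ u = c (t + 1) := by
  constructor
  · rintro ⟨hadj, hmem⟩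
    obtain ⟨r, hr⟩ := (hd _).1 hmem
    rw [hc.injective (congrArg Prod.fst hr)]
    exact congrArg Prod.snd hr
  · rintro rfl
    exact ⟨hc.adj t, (hd _).2 ⟨t, rfl⟩⟩

theorem traverses_iff_not_traverses_of_ne {b : V} {w : G.Walk b b} (hw : w.IsCycle) {v u u' : V}
    (hu : s(v, u) ∈ w.edges) (hu' : s(v, u') ∈ w.edges) (hne : u ≠ u') :
    Traverses w v u ↔ ¬ Traverses w v u' := by
  obtain ⟨c, hc, hd⟩ := exists_isEmbeddedCycle hw
  have edges_eq : ∀ e, e ∈ w.edges ↔ e ∈ cycleEdges c :=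
    Set.ext_iff.1 (edges_eq_cycleEdges hc hd)
  rw [edges_eq] at hu hu'
  obtain ⟨t, rfl⟩ := exists_eq_of_mem_cycleEdges hu (Sym2.mem_mk_left v u)
  rw [mk_mem_cycleEdges_iff hc.injective] at hu hu'
  rw [traverses_iff hc hd, traverses_iff hc hd]
  have := hc.add_one_ne_sub_one t
  grind

theorem traverses_iff_not_traverses_symm {b : V} {w : G.Walk b b} (hw : w.IsCycle) {v u : V}
    (hu : s(v, u) ∈ w.edges) : Traverses w v u ↔ ¬ Traverses w u v := by
  obtain ⟨c, hc, hd⟩ := exists_isEmbeddedCycle hw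
  have edges_eq : ∀ e, e ∈ w.edges ↔ e ∈ cycleEdges c :=
    Set.ext_iff.1 (edges_eq_cycleEdges hc hd)
  rw [edges_eq] at hu
  obtain ⟨t, rfl⟩ := exists_eq_of_mem_cycleEdges hu (Sym2.mem_mk_left v u)
  rw [mk_mem_cycleEdges_iff hc.injective] at hu
  rcases hu with rfl | rfl
  · have ne := hc.add_one_ne_sub_one (t + 1)
    rw [add_sub_cancel_right] at ne
    rw [traverses_iff hc hd, traverses_iff hc hd]
    exact iff_of_true rfl ne.symm
  · rw [traverses_iff hc hd, traverses_iff hc hd, sub_add_cancel]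
    exact iff_of_false (hc.add_one_ne_sub_one t).symm (not_not_intro rfl)

/-- The closed walks `w f` direct the boundaries of the faces in such a way that any two faces
traverse their common edges in opposite directions. -/
structure IsOrientation (G : SimpleGraph V) (bd : F → Set (Sym2 V)) {b : F → V}
    (w : ∀ f, G.Walk (b f) (b f)) : Prop where
  bounds : ∀ f, Bounds G bd f (w f)
  darts_disjoint : ∀ f f', f ≠ f' → ∀ d ∈ (w f).darts, d ∉ (w f').darts

namespace IsOrientation

variable {b : F → V} {w : ∀ f, G.Walk (b f) (b f)}

theorem traverses_iff_not_traverses_of_face_ne (h : IsOrientation G bd w) {v u : V} {f f' : F}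
    (hf : s(v, u) ∈ bd f) (hf' : s(v, u) ∈ bd f') (hne : f ≠ f') :
    Traverses (w f) v u ↔ ¬ Traverses (w f') v u := by
  have disjoint (x y : V) : Traverses (w f) x y → ¬ Traverses (w f') x y :=
    fun ⟨_, hd⟩ ⟨_, hd'⟩ => h.darts_disjoint f f' hne _ hd hd'
  have := traverses_iff_not_traverses_symm (h.bounds f).1 (((h.bounds f).2 _).2 hf)
  have := traverses_iff_not_traverses_symm (h.bounds f').1 (((h.bounds f').2 _).2 hf')
  have := disjoint v u
  have := disjoint u v
  tauto

theorem traverses_iff_mem_pos_iff (h : IsOrientation G bd w) (ha : IsAlternating G bd pos)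
    {v u u' : V} {f f' : F} (hf : s(v, u) ∈ bd f) (hf' : s(v, u') ∈ bd f') :
    (Traverses (w f) v u ↔ s(v, u) ∈ pos f) ↔ (Traverses (w f') v u' ↔ s(v, u') ∈ pos f') := by
  have change_face {u : V} {f f' : F} (hf : s(v, u) ∈ bd f) (hf' : s(v, u) ∈ bd f') :
      (Traverses (w f) v u ↔ s(v, u) ∈ pos f) ↔ (Traverses (w f') v u ↔ s(v, u) ∈ pos f') := by
    by_cases hne : f = f'
    · rw [hne]
    have := h.traverses_iff_not_traverses_of_face_ne hf hf' hne
    have := ha.mem_pos_iff_notMem_of_face_ne hf hf' hne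
    tauto
  have change_edge {f : F} (hu : s(v, u) ∈ bd f) (hu' : s(v, u') ∈ bd f) :
      (Traverses (w f) v u ↔ s(v, u) ∈ pos f) ↔ (Traverses (w f) v u' ↔ s(v, u') ∈ pos f) := by
    by_cases hne : u = u'
    · rw [hne]
    have := traverses_iff_not_traverses_of_ne (h.bounds f).1 (((h.bounds f).2 _).2 hu)
      (((h.bounds f).2 _).2 hu') hne
    have := ha.mem_pos_iff_notMem_of_edge_ne hu hu' hne
    tauto
  obtain ⟨g, hg, hg'⟩ :=
    ha.exists_common_face (ha.subset_edgeSet f hf) (ha.subset_edgeSet f' hf')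
  exact (change_face hf hg).trans ((change_edge hg hg').trans (change_face hg' hf'))

end IsOrientation

/-- At each vertex either all faces leave it along their positive edge there or all of them leave
it along the other one; the two cases alternate along every edge. -/
theorem IsAlternating.colorable_two_of_orientable (h : IsAlternating G bd pos)
    (ho : Orientable G bd) : G.Colorable 2 := by
  obtain ⟨b, w, hw, hd⟩ := ho
  have hw : IsOrientation G bd w := ⟨hw, hd⟩
  let color (v : V) : Prop :=
    ∃ u f, s(v, u) ∈ bd f ∧ (Traverses (w f) v u ↔ s(v, u) ∈ pos f)
  have color_iff {v u : V} {f : F} (hf : s(v, u) ∈ bd f) :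
      color v ↔ (Traverses (w f) v u ↔ s(v, u) ∈ pos f) :=
    ⟨fun ⟨_, _, hf', hv⟩ => (hw.traverses_iff_mem_pos_iff h hf' hf).1 hv, fun hv => ⟨u, f, hf, hv⟩⟩
  have color_ne {v u : V} (hvu : G.Adj v u) : color v ≠ color u := by
    obtain ⟨f, hf, -⟩ := h.exists_face_mem_pos_iff hvu True
    have hf' : s(u, v) ∈ bd f := Sym2.eq_swap ▸ hf
    have flip := traverses_iff_not_traverses_symm (hw.bounds f).1 (((hw.bounds f).2 _).2 hf)
    rw [ne_eq, eq_iff_iff, color_iff hf, color_iff hf', flip, Sym2.eq_swap (a := u)]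
    tauto
  simpa only [Fintype.card_prop] using (SimpleGraph.Coloring.mk color color_ne).colorable

/-! ### One-sided cycles -/

section OneSided

variable {n : ℕ} {c : ZMod n → V}

open Classical in
/-- One of the two sides of the cycle `c` at `c t`, encoded modulo `2`: the face `f` at `c t` lies
on the side `1` if it contains the next edge of `c` as a positive edge, or if it contains the
previous edge as a negative one. -/
noncomputable def side (bd pos : F → Set (Sym2 V)) (c : ZMod n → V) (t : ZMod n) (f : F) : ZMod 2 :=
  if s(c t, c (t + 1)) ∈ bd f ∧ s(c t, c (t + 1)) ∈ pos f ∨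
    s(c t, c (t + 1)) ∉ bd f ∧ s(c t, c (t - 1)) ∉ pos f then 1 else 0

open Classical in
theorem side_of_mem {t : ZMod n} {f : F} (hf : s(c t, c (t + 1)) ∈ bd f) :
    side bd pos c t f = if s(c t, c (t + 1)) ∈ pos f then 1 else 0 := by
  simp only [side, hf, true_and, not_true, false_and, or_false]

/-- The corners along the cycle with edge set `C`, that is, the vertices of `sideGraph bd C`. -/
abbrev Corner (bd : F → Set (Sym2 V)) (C : Set (Sym2 V)) : Type _ :=
  {x : V × F // (∃ e ∈ C, x.1 ∈ e) ∧ Touches bd x.1 x.2}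

/-- The corner of the face `f` at the vertex `c t` of the cycle `c`. -/
def corner (c : ZMod n → V) (t : ZMod n) {f : F} (hf : Touches bd (c t) f) :
    Corner bd (cycleEdges c) :=
  ⟨(c t, f), ⟨_, ⟨t, rfl⟩, Sym2.mem_mk_left _ _⟩, hf⟩

/-- The position along the cycle `c` of a corner, together with its side. -/
noncomputable def cornerLabel (pos : F → Set (Sym2 V)) (c : ZMod n → V)
    (x : Corner bd (cycleEdges c)) : ZMod n × ZMod 2 :=
  (Function.invFun c x.1.1, side bd pos c (Function.invFun c x.1.1) x.1.2)

theorem exists_eq_corner (x : Corner bd (cycleEdges c)) :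
    ∃ (t : ZMod n) (f : F) (hf : Touches bd (c t) f), x = corner c t hf := by
  obtain ⟨⟨v, f⟩, ⟨e, he, hv⟩, hf⟩ := x
  obtain ⟨t, rfl⟩ := exists_eq_of_mem_cycleEdges he hv
  exact ⟨t, f, hf, rfl⟩

namespace IsEmbeddedCycle

theorem cornerLabel_corner (hc : IsEmbeddedCycle G c) {t : ZMod n} {f : F}
    (hf : Touches bd (c t) f) : cornerLabel pos c (corner c t hf) = (t, side bd pos c t f) := by
  simp only [cornerLabel, corner, Function.leftInverse_invFun hc.injective t]

end IsEmbeddedCycle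

namespace IsAlternating

open Classical in
theorem side_of_sub_one_mem (h : IsAlternating G bd pos) (hc : IsEmbeddedCycle G c) {t : ZMod n}
    {f : F} (hf : s(c t, c (t - 1)) ∈ bd f) :
    side bd pos c t f = if s(c t, c (t - 1)) ∈ pos f then 0 else 1 := by
  by_cases hnext : s(c t, c (t + 1)) ∈ bd f
  · have := h.mem_pos_iff_notMem_of_edge_ne hnext hf (hc.add_one_ne_sub_one t)
    grind [side]
  · grind [side]

theorem side_add_one (h : IsAlternating G bd pos) (hc : IsEmbeddedCycle G c) {t : ZMod n} {f : F}
    (hf : s(c t, c (t + 1)) ∈ bd f) : side bd pos c (t + 1) f = side bd pos c t f + 1 := by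
  have side_next := h.side_of_sub_one_mem hc (t := t + 1) (f := f)
  rw [add_sub_cancel_right, Sym2.eq_swap] at side_next
  rw [side_next hf, side_of_mem hf]
  split_ifs <;> decide

theorem side_eq_side_iff (h : IsAlternating G bd pos) (hc : IsEmbeddedCycle G c) {t : ZMod n}
    {f f' : F} (hf : Touches bd (c t) f) (hf' : Touches bd (c t) f') :
    side bd pos c t f = side bd pos c t f' ↔
      f = f' ∨ ∃ e ∉ cycleEdges c, c t ∈ e ∧ e ∈ bd f ∧ e ∈ bd f' := by
  obtain ⟨nb, fc, H⟩ := h.exists_alternatingAt (c t)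
  obtain ⟨i, hi⟩ := (H.adj_iff _).1 (hc.adj t)
  obtain ⟨j, hj⟩ := (H.adj_iff _).1 (hc.adj_sub_one t)
  obtain ⟨m, rfl⟩ := H.exists_eq_of_touches f hf
  obtain ⟨m', rfl⟩ := H.exists_eq_of_touches f' hf'
  have hij : i ≠ j := by
    rintro rfl
    exact hc.add_one_ne_sub_one t (hi.trans hj.symm)
  have side_fc (m : Fin 3) : side bd pos c t (fc m) =
      if i ≠ m ∧ i = m + 1 ∨ ¬ i ≠ m ∧ j ≠ m + 1 then 1 else 0 := by
    simp only [side, hi, hj, H.mem_bd_iff, H.mem_pos_iff, ne_eq]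
  rw [side_fc, side_fc]
  have mem_cycle (l : Fin 3) : s(c t, nb l) ∈ cycleEdges c ↔ l = i ∨ l = j := by
    rw [mk_mem_cycleEdges_iff hc.injective, hi, hj, H.nb_injective.eq_iff, H.nb_injective.eq_iff]
  constructor
  · intro heq
    have exists_index : m = m' ∨ ∃ l, ¬ (l = i ∨ l = j) ∧ l ≠ m ∧ l ≠ m' := by
      clear side_fc mem_cycle H h hi hj hc hf hf'
      decide +revert
    refine exists_index.imp (congrArg fc) fun ⟨l, hl, hm, hm'⟩ => ⟨s(c t, nb l), ?_⟩
    exact ⟨(mem_cycle l).not.2 hl, Sym2.mem_mk_left _ _, (H.mem_bd_iff _ _).2 hm,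
      (H.mem_bd_iff _ _).2 hm'⟩
  · rintro (heq | ⟨e, he, ⟨u, rfl⟩, hu, hu'⟩)
    · rw [← side_fc, ← side_fc, heq]
    · obtain ⟨l, rfl⟩ := (H.adj_iff u).1 (h.subset_edgeSet _ hu)
      rw [mem_cycle] at he
      rw [H.mem_bd_iff] at hu hu'
      clear side_fc mem_cycle H h hi hj hc hf hf'
      decide +revert

theorem exists_face_side_eq (h : IsAlternating G bd pos) (hc : IsEmbeddedCycle G c) (t : ZMod n)
    (x : ZMod 2) : ∃ f, s(c t, c (t + 1)) ∈ bd f ∧ side bd pos c t f = x := by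
  obtain ⟨f, hf, hpos⟩ := h.exists_face_mem_pos_iff (hc.adj t) (x = 1)
  refine ⟨f, hf, ?_⟩
  have eq_zero_of_ne_one : ∀ y : ZMod 2, y ≠ 1 → 0 = y := by decide
  rw [side_of_mem hf]
  split_ifs with hmem
  · exact (hpos.1 hmem).symm
  · exact eq_zero_of_ne_one x (mt hpos.2 hmem)

theorem cornerLabel_add_one (h : IsAlternating G bd pos) (hc : IsEmbeddedCycle G c) {t : ZMod n}
    {f : F} (hf : s(c t, c (t + 1)) ∈ bd f) (ht : Touches bd (c t) f)
    (ht' : Touches bd (c (t + 1)) f) :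
    cornerLabel pos c (corner c (t + 1) ht') = cornerLabel pos c (corner c t ht) + 1 := by
  rw [hc.cornerLabel_corner, hc.cornerLabel_corner, h.side_add_one hc hf]
  rfl

theorem cornerLabel_of_adj (h : IsAlternating G bd pos) (hc : IsEmbeddedCycle G c)
    {x y : Corner bd (cycleEdges c)} (hxy : (sideGraph bd (cycleEdges c)).Adj x y) :
    ∃ m : ℤ, cornerLabel pos c y = cornerLabel pos c x + m := by
  wlog hrel : (x.1.1 = y.1.1 ∧ ∃ e, e ∉ cycleEdges c ∧ x.1.1 ∈ e ∧ e ∈ bd x.1.2 ∧ e ∈ bd y.1.2) ∨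
    (x.1.2 = y.1.2 ∧ s(x.1.1, y.1.1) ∈ cycleEdges c ∧ s(x.1.1, y.1.1) ∈ bd x.1.2) generalizing x y
  · obtain ⟨m, hm⟩ := this hxy.symm (hxy.2.resolve_left hrel)
    exact ⟨-m, by rw [hm, Int.cast_neg, add_neg_cancel_right]⟩
  obtain ⟨t, f, hf, rfl⟩ := exists_eq_corner x
  obtain ⟨r, g, hg, rfl⟩ := exists_eq_corner y
  obtain ⟨heq, hglued⟩ | ⟨heq, hmem, hf'⟩ := hrel
  · obtain rfl := hc.injective heq
    refine ⟨0, ?_⟩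
    rw [hc.cornerLabel_corner, hc.cornerLabel_corner,
      (h.side_eq_side_iff hc hf hg).2 (.inr hglued), Int.cast_zero, add_zero]
  · obtain rfl : f = g := heq
    rcases (mk_mem_cycleEdges_iff hc.injective).1 hmem with hr | hr
    · obtain rfl := hc.injective hr
      refine ⟨1, ?_⟩
      rw [h.cornerLabel_add_one (f := f) hc hf' hf hg, Int.cast_one]
    · obtain rfl := eq_sub_iff_add_eq.1 (hc.injective hr)
      refine ⟨-1, ?_⟩
      rw [h.cornerLabel_add_one (f := f) hc (Sym2.eq_swap ▸ hf') hg hf, Int.cast_neg, Int.cast_one,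
        add_neg_cancel_right]

theorem reachable_of_cornerLabel_eq (h : IsAlternating G bd pos) (hc : IsEmbeddedCycle G c)
    {x y : Corner bd (cycleEdges c)} (hxy : cornerLabel pos c x = cornerLabel pos c y) :
    (sideGraph bd (cycleEdges c)).Reachable x y := by
  by_cases hne : x = y
  · rw [hne]
  obtain ⟨t, f, hf, rfl⟩ := exists_eq_corner x
  obtain ⟨r, g, hg, rfl⟩ := exists_eq_corner y
  rw [hc.cornerLabel_corner, hc.cornerLabel_corner, Prod.mk.injEq] at hxy
  obtain ⟨rfl, hside⟩ := hxy
  rcases (h.side_eq_side_iff hc hf hg).1 hside with rfl | hglued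
  · rfl
  · exact SimpleGraph.Adj.reachable ⟨hne, .inl (.inl ⟨rfl, hglued⟩)⟩

theorem exists_reachable_cornerLabel_add_one (h : IsAlternating G bd pos)
    (hc : IsEmbeddedCycle G c) (x : Corner bd (cycleEdges c)) :
    ∃ y, (sideGraph bd (cycleEdges c)).Reachable x y ∧
      cornerLabel pos c y = cornerLabel pos c x + 1 := by
  obtain ⟨t, f, hf, rfl⟩ := exists_eq_corner x
  obtain ⟨g, hg, hside⟩ := h.exists_face_side_eq hc t (side bd pos c t f)
  have touches_t : Touches bd (c t) g := touches_of_mem hg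
  have touches_succ : Touches bd (c (t + 1)) g := ⟨_, hg, Sym2.mem_mk_right _ _⟩
  have same_label :
      cornerLabel pos c (corner c t hf) = cornerLabel pos c (corner c t touches_t) := by
    rw [hc.cornerLabel_corner, hc.cornerLabel_corner, hside]
  refine ⟨corner c (t + 1) touches_succ, ?_, ?_⟩
  · refine (h.reachable_of_cornerLabel_eq hc same_label).trans (SimpleGraph.Adj.reachable ⟨?_, ?_⟩)
    · exact fun heq => (hc.adj t).ne (congrArg (fun x => x.1.1) heq)
    · exact .inl (.inr ⟨rfl, ⟨t, rfl⟩, hg⟩)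
  · rw [h.cornerLabel_add_one hc hg touches_t, same_label]

theorem reachable_iff_cornerLabel (h : IsAlternating G bd pos) (hc : IsEmbeddedCycle G c)
    {x y : Corner bd (cycleEdges c)} : (sideGraph bd (cycleEdges c)).Reachable x y ↔
      ∃ m : ℤ, cornerLabel pos c y = cornerLabel pos c x + m := by
  constructor
  · rintro ⟨p⟩
    induction p with
    | nil => exact ⟨0, by rw [Int.cast_zero, add_zero]⟩
    | cons hadj _ ih =>
      obtain ⟨m, hm⟩ := h.cornerLabel_of_adj hc hadj
      obtain ⟨m', hm'⟩ := ih
      exact ⟨m + m', by rw [hm', hm, Int.cast_add, add_assoc]⟩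
  · rintro ⟨m, hm⟩
    induction m generalizing x y with
    | zero => exact h.reachable_of_cornerLabel_eq hc (by rw [hm, Int.cast_zero, add_zero])
    | succ m ih =>
      obtain ⟨z, hxz, hz⟩ := h.exists_reachable_cornerLabel_add_one hc x
      refine hxz.trans (ih ?_)
      rw [hm, hz, Int.cast_add, Int.cast_one, add_assoc, add_comm (1 : ZMod n × ZMod 2)]
    | pred m ih =>
      obtain ⟨z, hyz, hz⟩ := h.exists_reachable_cornerLabel_add_one hc y
      refine (ih ?_).trans hyz.symm
      rw [hz, hm, Int.cast_sub, Int.cast_one, add_assoc, sub_add_cancel]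

theorem cornerLabel_surjective (h : IsAlternating G bd pos) (hc : IsEmbeddedCycle G c) :
    Function.Surjective (cornerLabel (bd := bd) pos c) := by
  rintro ⟨t, x⟩
  obtain ⟨f, hf, hside⟩ := h.exists_face_side_eq hc t x
  exact ⟨corner c t (touches_of_mem hf), by rw [hc.cornerLabel_corner, hside]⟩

end IsAlternating

theorem surjective_intCast_prod_zmod_two_iff :
    Function.Surjective (Int.cast : ℤ → ZMod n × ZMod 2) ↔ Odd n := by
  constructor
  · intro hsurj
    obtain ⟨m, hm⟩ := hsurj (0, 1)
    have m_zero : (m : ZMod n) = 0 := congrArg Prod.fst hm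
    have m_one : (m : ZMod 2) = 1 := congrArg Prod.snd hm
    rw [ZMod.intCast_zmod_eq_zero_iff_dvd] at m_zero
    rw [ZMod.intCast_eq_one_iff_odd] at m_one
    exact Odd.of_dvd_nat (Int.natAbs_odd.2 m_one) (Int.natCast_dvd.1 m_zero)
  · intro hodd x
    have hcop : n.Coprime 2 := Nat.coprime_two_right.2 hodd
    obtain ⟨m, hm⟩ := ZMod.intCast_surjective ((ZMod.chineseRemainder hcop).symm x)
    exact ⟨m, by rw [← map_intCast (ZMod.chineseRemainder hcop), hm, RingEquiv.apply_symm_apply]⟩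

theorem IsAlternating.oneSided_cycleEdges_iff (h : IsAlternating G bd pos)
    (hc : IsEmbeddedCycle G c) : OneSided bd (cycleEdges c) ↔ Odd n := by
  have hsurj := h.cornerLabel_surjective hc
  rw [← surjective_intCast_prod_zmod_two_iff, OneSided, SimpleGraph.connected_iff]
  constructor
  · rintro ⟨hconn, -⟩ x
    obtain ⟨u, hu⟩ := hsurj 0
    obtain ⟨v, hv⟩ := hsurj x
    obtain ⟨m, hm⟩ := (h.reachable_iff_cornerLabel hc).1 (hconn u v)
    exact ⟨m, by rw [← hv, hm, hu, zero_add]⟩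
  · refine fun hcast => ⟨fun u v => (h.reachable_iff_cornerLabel hc).2 ?_, hsurj.nonempty⟩
    obtain ⟨m, hm⟩ := hcast (cornerLabel pos c v - cornerLabel pos c u)
    exact ⟨m, by rw [hm, add_sub_cancel]⟩

theorem IsAlternating.odd_length_iff_oneSided (h : IsAlternating G bd pos) {v : V}
    {w : G.Walk v v} (hw : w.IsCycle) : Odd w.length ↔ OneSided bd {e | e ∈ w.edges} := by
  obtain ⟨c, hc, hd⟩ := exists_isEmbeddedCycle hw
  rw [edges_eq_cycleEdges hc hd, h.oneSided_cycleEdges_iff hc]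

end OneSided

end SurfaceMap

/-! ### The plane hexagon lattice as a covering of `K_o(k, q)` -/

namespace Ko

open SurfaceMap

variable {k q : ℕ} {s m t : ℤ} {p p' r a : ℤ × ℤ}

/-- The quotient map of the plane lattice by the group generated by the translation by `(0, q)` and
the glide reflection `(i, j) ↦ (i + k, s - j)`, with values in the fundamental domain. -/
def proj (k q : ℕ) (s : ℤ) (p : ℤ × ℤ) : Vert k q :=
  (p.1, if Even (p.1 / k) then p.2 else s - p.2)

/-- An arbitrary element of the group generated by the translation by `(0, q)` and the glide
reflection `(i, j) ↦ (i + k, s - j)`. -/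
def deck (k q : ℕ) (s m t : ℤ) (p : ℤ × ℤ) : ℤ × ℤ :=
  (p.1 + m * k, (if Even m then p.2 else s - p.2) + t * q)

theorem proj_deck (hk : 0 < k) : proj k q s (deck k q s m t p) = proj k q s p := by
  simp only [proj, deck, Int.add_mul_ediv_right _ _ (Nat.cast_ne_zero.2 hk.ne'), Int.even_add]
  by_cases hm : Even m <;> by_cases hp : Even (p.1 / (k : ℤ)) <;> simp [hm, hp]

theorem proj_eq_proj_iff (hk : 0 < k) :
    proj k q s p = proj k q s p' ↔ ∃ m t, p' = deck k q s m t p := by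
  constructor
  · intro h
    have fst_eq : (p.1 : ZMod k) = p'.1 := congrArg Prod.fst h
    obtain ⟨m, hm⟩ := (ZMod.intCast_eq_intCast_iff_dvd_sub _ _ _).1 fst_eq
    have hp' : p'.1 = p.1 + m * k := by linear_combination hm
    have snd_eq : (p'.2 : ZMod q) = (if Even m then p.2 else s - p.2 : ℤ) := by
      have := congrArg Prod.snd h
      simp only [proj, hp', Int.add_mul_ediv_right _ _ (Nat.cast_ne_zero.2 hk.ne'), Int.even_add]
        at this
      by_cases hm : Even m <;> by_cases hp : Even (p.1 / (k : ℤ)) <;>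
        simp [hm, hp] at this ⊢ <;> grind
    obtain ⟨t, ht⟩ := (ZMod.intCast_eq_intCast_iff_dvd_sub _ _ _).1 snd_eq.symm
    exact ⟨m, t, Prod.ext hp' (by rw [deck]; linear_combination ht)⟩
  · rintro ⟨m, t, rfl⟩
    exact (proj_deck hk).symm

theorem proj_eq_proj_iff_of_abs_lt (h : |p'.1 - p.1| < k) :
    proj k q s p = proj k q s p' ↔ p'.1 = p.1 ∧ (q : ℤ) ∣ p'.2 - p.2 := by
  have hk : 0 < k := by exact_mod_cast (abs_nonneg _).trans_lt h
  rw [proj_eq_proj_iff hk]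
  constructor
  · rintro ⟨m, t, rfl⟩
    rw [deck, add_sub_cancel_left] at h
    have hm : m * k = 0 := Int.eq_zero_of_abs_lt_dvd (dvd_mul_left (k : ℤ) m) h
    obtain rfl : m = 0 := (mul_eq_zero.1 hm).resolve_right (by exact_mod_cast hk.ne')
    simp [deck]
  · rintro ⟨hfst, t, ht⟩
    refine ⟨0, t, Prod.ext ?_ ?_⟩
    · simp only [deck, zero_mul, add_zero, hfst]
    · simp only [deck, Even.zero, if_true]
      linear_combination ht

theorem exists_deck_eq_natCast (hk : 0 < k) (hq : 0 < q) (s : ℤ) (p : ℤ × ℤ) :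
    ∃ (m t : ℤ) (a b : ℕ), a < k ∧ b < q ∧ deck k q s m t p = (↑a, ↑b) := by
  have residue {n : ℕ} (hn : 0 < n) (x : ℤ) : ∃ (y : ℤ) (b : ℕ), b < n ∧ x + y * n = b := by
    have hn' : (n : ℤ) ≠ 0 := by exact_mod_cast hn.ne'
    obtain ⟨b, hb⟩ := Int.eq_ofNat_of_zero_le (Int.emod_nonneg x hn')
    have := Int.emod_lt_of_pos x (b := n) (by omega)
    exact ⟨-(x / n), b, by omega, by rw [← hb, Int.emod_def]; ring⟩
  obtain ⟨m, a, ha, hma⟩ := residue hk p.1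
  obtain ⟨t, b, hb, htb⟩ := residue hq (if Even m then p.2 else s - p.2)
  exact ⟨m, t, a, b, ha, hb, Prod.ext hma htb⟩

theorem even_deck_iff (hq : Even q) :
    Even ((deck k q s m t p).1 + (deck k q s m t p).2) ↔
      (Even (p.1 + p.2) ↔ Even m ∨ (Even k ↔ Even s)) := by
  have hq' : Even (q : ℤ) := by exact_mod_cast hq
  by_cases hm : Even m <;>
    simp only [deck, hm, if_true, if_false, Int.even_add, Int.even_mul, Int.even_sub, hq',
      Int.even_coe_nat] <;>
    tauto

/-- The hexagon lattice that fills the whole plane, drawn as a wall of bricks. -/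
def brickWall : SimpleGraph (ℤ × ℤ) :=
  SimpleGraph.fromRel fun p r => r = (p.1 + 1, p.2) ∨ Even (p.1 + p.2) ∧ r = (p.1, p.2 + 1)

theorem brickWall_adj : brickWall.Adj p r ↔
    p.2 = r.2 ∧ (r.1 = p.1 + 1 ∨ p.1 = r.1 + 1) ∨
    p.1 = r.1 ∧ (Even (p.1 + p.2) ∧ r.2 = p.2 + 1 ∨ Even (r.1 + r.2) ∧ p.2 = r.2 + 1) := by
  simp only [brickWall, SimpleGraph.fromRel_adj, ne_eq, Prod.ext_iff, Int.even_iff]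
  omega

theorem brickWall_connected : brickWall.Connected := by
  have right (p : ℤ × ℤ) : brickWall.Reachable p (p.1 + 1, p.2) :=
    (brickWall_adj.2 (by simp)).reachable
  have up (p : ℤ × ℤ) : brickWall.Reachable p (p.1, p.2 + 1) := by
    by_cases hp : Even (p.1 + p.2)
    · exact (brickWall_adj.2 (by simp [hp])).reachable
    · have adj_up : brickWall.Adj (p.1 + 1, p.2) (p.1 + 1, p.2 + 1) := by
        refine brickWall_adj.2 (.inr ⟨rfl, .inl ⟨?_, rfl⟩⟩)
        rw [Int.even_iff] at hp ⊢
        omega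
      exact (right p).trans (adj_up.reachable.trans (right (p.1, p.2 + 1)).symm)
  have row (j n : ℤ) : brickWall.Reachable (0, j) (n, j) := by
    induction n with
    | zero => rfl
    | succ n ih => exact ih.trans (right _)
    | pred n ih => exact ih.trans (by simpa using (right (-n - 1, j)).symm)
  have column (n : ℤ) : brickWall.Reachable (0, 0) (0, n) := by
    induction n with
    | zero => rfl
    | succ n ih => exact ih.trans (up _)
    | pred n ih => exact ih.trans (by simpa using (up (0, -n - 1)).symm)
  exact (SimpleGraph.connected_iff_exists_forall_reachable _).2
    ⟨(0, 0), fun p => (column p.2).trans (row p.2 p.1)⟩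

/-- Colour the points of the plane lattice by the parity of the sum of their coordinates. -/
def parityColoring : brickWall.Coloring Bool :=
  SimpleGraph.Coloring.mk (fun p => decide (Even (p.1 + p.2))) fun {p r} h => by
    simp only [brickWall_adj, Int.even_iff, ne_eq, decide_eq_decide] at h ⊢
    omega

/-- The sum of the second coordinates of two points with the first coordinates `0` and `k` that are
identified in `K_o(k, q)`. -/
def glueSum (k : ℕ) : ℤ := if Even k then -1 else -2

theorem even_glueSum_iff : Even (glueSum k) ↔ ¬ Even k := by
  by_cases hk : Even k
  · simp only [glueSum, hk]
    decide
  · simp only [glueSum, hk]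
    decide

theorem even_deck_glueSum_iff (hq : Even q) :
    Even ((deck k q (glueSum k) m t p).1 + (deck k q (glueSum k) m t p).2) ↔
      (Even (p.1 + p.2) ↔ Even m) := by
  rw [even_deck_iff hq, even_glueSum_iff]
  tauto

theorem even_deck_glueSum_sub_one_iff (hq : Even q) :
    Even ((deck k q (glueSum k - 1) m t p).1 + (deck k q (glueSum k - 1) m t p).2) ↔
      Even (p.1 + p.2) := by
  rw [even_deck_iff hq, Int.even_sub, even_glueSum_iff]
  simp

theorem brickWall_adj_deck (hq : Even q) (m t : ℤ) (h : brickWall.Adj p r) :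
    brickWall.Adj (deck k q (glueSum k) m t p) (deck k q (glueSum k) m t r) := by
  rw [brickWall_adj, even_deck_glueSum_iff hq, even_deck_glueSum_iff hq]
  rw [brickWall_adj] at h
  by_cases hm : Even m <;>
    simp only [deck, hm, if_true, if_false, iff_true, iff_false, Int.even_iff] at h ⊢ <;>
    omega

/-- The vertex of `K_o(k, q)` covered by a point of the plane lattice. -/
def vert (k q : ℕ) (p : ℤ × ℤ) : Vert k q := proj k q (glueSum k) p

theorem vert_deck (hk : 0 < k) : vert k q (deck k q (glueSum k) m t p) = vert k q p :=
  proj_deck hk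

theorem pt_eq_vert {a b : ℕ} (ha : a < 2 * k) : pt k q (a, b) = vert k q (a, b) := by
  rcases lt_or_ge a k with h | h
  · have hdiv : (a : ℤ) / k = 0 := Int.ediv_eq_zero_of_lt (by omega) (by omega)
    simp [pt, vert, proj, h, hdiv]
  · have hdiv : (a : ℤ) / k = 1 := by
      rw [Int.ediv_eq_iff_of_pos (by omega)]
      omega
    by_cases hke : Even k <;> simp [pt, vert, proj, glueSum, h, h.not_gt, hdiv, hke]

theorem vert_surjective [NeZero k] [NeZero q] : Function.Surjective (vert k q) := by
  rintro ⟨i, j⟩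
  have hdiv : (i.val : ℤ) / k = 0 :=
    Int.ediv_eq_zero_of_lt (by omega) (by exact_mod_cast ZMod.val_lt i)
  refine ⟨(i.val, j.val), ?_⟩
  rw [vert, proj, hdiv]
  simp

theorem vert_ne_of_adj (hk : 2 ≤ k) (hq : Even q) (h : brickWall.Adj p r) :
    vert k q p ≠ vert k q r := by
  intro heq
  rw [brickWall_adj] at h
  have hlt : |r.1 - p.1| < k := by
    rw [abs_lt]
    omega
  obtain ⟨hfst, hsnd⟩ := (proj_eq_proj_iff_of_abs_lt hlt).1 heq
  have := (Int.natCast_dvd_natCast.2 hq.two_dvd).trans hsnd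
  omega

theorem exists_brickWall_adj_of_latticeEdge (hk : 2 ≤ k) {p r : ℕ × ℕ} (h : LatticeEdge k q p r) :
    ∃ p' r', brickWall.Adj p' r' ∧ pt k q p = vert k q p' ∧ pt k q r = vert k q r' := by
  refine ⟨(p.1, p.2), (r.1, r.2), ?_, pt_eq_vert ?_, pt_eq_vert ?_⟩
  · rw [brickWall_adj]
    simp only [LatticeEdge, Int.even_iff, Prod.ext_iff] at h ⊢
    omega
  all_goals
    simp only [LatticeEdge, Prod.ext_iff] at h
    omega

theorem exists_latticeEdge_right (hk : 0 < k) (hq : 0 < q) (p : ℤ × ℤ) :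
    ∃ x y, LatticeEdge k q x y ∧
      s(pt k q x, pt k q y) = s(vert k q p, vert k q (p.1 + 1, p.2)) := by
  obtain ⟨m, t, a, b, ha, hb, hab⟩ := exists_deck_eq_natCast hk hq (glueSum k) p
  have hab' : deck k q (glueSum k) m t (p.1 + 1, p.2) = (↑(a + 1), ↑b) := by
    simp only [deck, Prod.mk.injEq] at hab ⊢
    exact ⟨by push_cast; linear_combination hab.1, hab.2⟩
  refine ⟨(a, b), (a + 1, b), .inl ⟨ha, hb.le, rfl⟩, ?_⟩
  rw [pt_eq_vert (by omega), pt_eq_vert (by omega), ← hab, ← hab', vert_deck hk, vert_deck hk]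

theorem exists_latticeEdge_up (hk : 0 < k) (hq : Even q) (hq0 : 0 < q) (hp : Even (p.1 + p.2)) :
    ∃ x y, LatticeEdge k q x y ∧
      s(pt k q x, pt k q y) = s(vert k q p, vert k q (p.1, p.2 + 1)) := by
  -- `glueSum k - 1` instead of `glueSum k`, as a reflection turns the edge upside down
  obtain ⟨m, t, a, b, ha, hb, hab⟩ := exists_deck_eq_natCast hk hq0 (glueSum k - 1) p
  have hpar : Even ((a : ℤ) + b) := by
    have := (even_deck_glueSum_sub_one_iff (k := k) (m := m) (t := t) hq).2 hp
    rwa [hab] at this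
  rw [Int.even_iff] at hpar
  refine ⟨(a, b), (a, b + 1), .inr ⟨ha.le, hb, by simp only; omega, rfl⟩, ?_⟩
  rw [pt_eq_vert (by omega), pt_eq_vert (by omega)]
  simp only [deck, Prod.mk.injEq] at hab
  by_cases hm : Even m <;> simp only [hm, if_true, if_false] at hab
  · have lower : deck k q (glueSum k) m t p = (↑a, ↑b) := by
      simp only [deck, hm, if_true, hab]
    have upper : deck k q (glueSum k) m t (p.1, p.2 + 1) = (↑a, ↑(b + 1)) := by
      simp only [deck, hm, if_true, hab.1, Prod.mk.injEq, true_and]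
      push_cast
      linear_combination hab.2
    rw [← lower, ← upper, vert_deck hk, vert_deck hk]
  · have lower : deck k q (glueSum k) m t (p.1, p.2 + 1) = (↑a, ↑b) := by
      simp only [deck, hm, if_false, hab.1, Prod.mk.injEq, true_and]
      linear_combination hab.2
    have upper : deck k q (glueSum k) m t p = (↑a, ↑(b + 1)) := by
      simp only [deck, hm, if_false, hab.1, Prod.mk.injEq, true_and]
      push_cast
      linear_combination hab.2
    rw [← lower, ← upper, vert_deck hk, vert_deck hk, Sym2.eq_swap]

theorem exists_latticeEdge_of_brickWall_adj (hk : 0 < k) (hq : Even q) (hq0 : 0 < q)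
    (h : brickWall.Adj p r) :
    ∃ x y, LatticeEdge k q x y ∧ s(pt k q x, pt k q y) = s(vert k q p, vert k q r) := by
  obtain ⟨-, (rfl | ⟨hp, rfl⟩) | (rfl | ⟨hr, rfl⟩)⟩ := (SimpleGraph.fromRel_adj _ _ _).1 h
  · exact exists_latticeEdge_right hk hq0 p
  · exact exists_latticeEdge_up hk hq hq0 hp
  · rw [Sym2.eq_swap (a := vert k q _)]
    exact exists_latticeEdge_right hk hq0 r
  · rw [Sym2.eq_swap (a := vert k q _)]
    exact exists_latticeEdge_up hk hq hq0 hr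

theorem graph_adj_of_brickWall_adj (hk : 2 ≤ k) (hq : Even q) (hq0 : 0 < q)
    (h : brickWall.Adj p r) : (graph k q).Adj (vert k q p) (vert k q r) := by
  obtain ⟨x, y, hxy, heq⟩ := exists_latticeEdge_of_brickWall_adj (k := k) (by omega) hq hq0 h
  rw [graph, SimpleGraph.fromRel_adj]
  refine ⟨vert_ne_of_adj hk hq h, ?_⟩
  exact (Sym2.eq_iff.1 heq).imp (fun ⟨hx, hy⟩ => ⟨x, y, hxy, hx, hy⟩)
    fun ⟨hx, hy⟩ => ⟨x, y, hxy, hx, hy⟩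

theorem exists_brickWall_adj_of_graph_adj (hk : 2 ≤ k) {v u : Vert k q}
    (h : (graph k q).Adj v u) :
    ∃ p r, brickWall.Adj p r ∧ vert k q p = v ∧ vert k q r = u := by
  obtain ⟨-, ⟨x, y, hxy, rfl, rfl⟩ | ⟨x, y, hxy, rfl, rfl⟩⟩ := (SimpleGraph.fromRel_adj _ _ _).1 h
  · obtain ⟨p, r, hadj, hx, hy⟩ := exists_brickWall_adj_of_latticeEdge hk hxy
    exact ⟨p, r, hadj, hx.symm, hy.symm⟩
  · obtain ⟨p, r, hadj, hx, hy⟩ := exists_brickWall_adj_of_latticeEdge hk hxy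
    exact ⟨r, p, hadj.symm, hy.symm, hx.symm⟩

theorem graph_adj_vert_iff (hk : 2 ≤ k) (hq : Even q) (hq0 : 0 < q) {u : Vert k q} :
    (graph k q).Adj (vert k q p) u ↔ ∃ r, brickWall.Adj p r ∧ vert k q r = u := by
  refine ⟨fun h => ?_, fun ⟨r, h, hr⟩ => hr ▸ graph_adj_of_brickWall_adj hk hq hq0 h⟩
  obtain ⟨p', r, hadj, hp', hr⟩ := exists_brickWall_adj_of_graph_adj hk h
  obtain ⟨m, t, rfl⟩ := (proj_eq_proj_iff (by omega)).1 hp'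
  exact ⟨_, brickWall_adj_deck hq m t hadj, by rw [vert_deck (by omega), hr]⟩

/-- The covering `vert` as a graph homomorphism. -/
def vertHom (hk : 2 ≤ k) (hq : Even q) (hq0 : 0 < q) : brickWall →g graph k q :=
  ⟨vert k q, graph_adj_of_brickWall_adj hk hq hq0⟩

theorem graph_connected (hk : 2 ≤ k) (hq : Even q) (hq0 : 0 < q) : (graph k q).Connected :=
  have : NeZero k := ⟨by omega⟩
  have : NeZero q := ⟨by omega⟩
  brickWall_connected.map (vertHom hk hq hq0) vert_surjective

theorem not_colorable_two (hk : 2 ≤ k) (hq : Even q) (hq0 : 0 < q) :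
    ¬ (graph k q).Colorable 2 := by
  obtain ⟨w⟩ := brickWall_connected (0, 0) (deck k q (glueSum k) 1 0 (0, 0))
  have w_odd : Odd w.length := by
    rw [parityColoring.odd_length_iff_not_congr w]
    have parity (p : ℤ × ℤ) : parityColoring p = true ↔ Even (p.1 + p.2) := decide_eq_true_iff
    rw [parity, parity, even_deck_glueSum_iff hq]
    decide
  rw [SimpleGraph.two_colorable_iff_forall_loop_even]
  intro even_length
  have closed : vertHom hk hq hq0 (deck k q (glueSum k) 1 0 (0, 0)) = vertHom hk hq hq0 (0, 0) :=
    vert_deck (by omega)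
  have w_even := even_length _ ((w.map (vertHom hk hq hq0)).copy rfl closed)
  rw [SimpleGraph.Walk.length_copy, SimpleGraph.Walk.length_map] at w_even
  exact Nat.not_even_iff_odd.2 w_odd w_even

/-! ### The faces and their signed edges -/

/-- The corners of the hexagon with the lower left corner `(0, 0)`, in counterclockwise order. -/
def offset : ZMod 6 → ℤ × ℤ := (![(0, 0), (1, 0), (2, 0), (2, 1), (1, 1), (0, 1)] : Fin 6 → ℤ × ℤ)

/-- The corners in `K_o(k, q)` of the hexagon of the plane lattice with the lower left corner `a`,
in counterclockwise order. -/
def hexagon (k q : ℕ) (a : ℤ × ℤ) (r : ZMod 6) : Vert k q := vert k q (a + offset r)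

theorem offset_five_sub (r : ZMod 6) : offset (5 - r) = ((offset r).1, 1 - (offset r).2) := by
  decide +revert

theorem deck_add_offset (r : ZMod 6) : deck k q s m t (a + offset r) =
    deck k q (s - 1) m t a + offset (if Even m then r else 5 - r) := by
  by_cases hm : Even m
  · simp only [deck, hm, if_true, Prod.fst_add, Prod.snd_add, Prod.ext_iff]
    exact ⟨by ring, by ring⟩
  · simp only [deck, hm, if_false, offset_five_sub, Prod.fst_add, Prod.snd_add, Prod.ext_iff]
    exact ⟨by ring, by ring⟩

theorem hexagon_deck (hk : 0 < k) (m t : ℤ) (a : ℤ × ℤ) :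
    hexagon k q (deck k q (glueSum k - 1) m t a) =
      if Even m then hexagon k q a else fun r => hexagon k q a (5 - r) := by
  funext r
  have lift := deck_add_offset (k := k) (q := q) (s := glueSum k) (m := m) (t := t) (a := a)
    (if Even m then r else 5 - r)
  by_cases hm : Even m <;> simp only [hm, if_true, if_false, sub_sub_cancel] at lift ⊢ <;>
    rw [hexagon, ← lift, vert_deck hk, hexagon]

theorem hexagon_injective (hk : 3 ≤ k) (hq : Even q) (a : ℤ × ℤ) :
    Function.Injective (hexagon k q a) := by
  intro r r' h
  have width : ∀ r r' : ZMod 6, |(offset r').1 - (offset r).1| ≤ 2 := by decide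
  have offset_inj : ∀ r r' : ZMod 6, (offset r').1 = (offset r).1 →
    2 ∣ (offset r').2 - (offset r).2 → r = r' := by decide
  have hlt : |(a + offset r').1 - (a + offset r).1| < k := by
    rw [Prod.fst_add, Prod.fst_add, add_sub_add_left_eq_sub]
    exact (width r r').trans_lt (by omega)
  obtain ⟨hfst, hsnd⟩ := (proj_eq_proj_iff_of_abs_lt hlt).1 h
  rw [Prod.snd_add, Prod.snd_add, add_sub_add_left_eq_sub] at hsnd
  exact offset_inj r r' (add_left_cancel hfst)
    ((Int.natCast_dvd_natCast.2 hq.two_dvd).trans hsnd)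

theorem brickWall_adj_add_offset (ha : Even (a.1 + a.2)) (r : ZMod 6) :
    brickWall.Adj (a + offset r) (a + offset (r + 1)) := by
  have adj_offset : ∀ r : ZMod 6, brickWall.Adj (offset r) (offset (r + 1)) := by
    simp only [brickWall_adj]
    decide
  have := adj_offset r
  simp only [brickWall_adj, Prod.fst_add, Prod.snd_add, Int.even_iff] at ha this ⊢
  omega

theorem isEmbeddedCycle_hexagon (hk : 3 ≤ k) (hq : Even q) (hq0 : 0 < q)
    (ha : Even (a.1 + a.2)) : IsEmbeddedCycle (graph k q) (hexagon k q a) where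
  three_le := by norm_num
  injective := hexagon_injective hk hq a
  adj r := graph_adj_of_brickWall_adj (by omega) hq hq0 (brickWall_adj_add_offset ha r)

/-- The lower left corner of a face in the fundamental domain. -/
def lowerLeft (f : Face k q) : ℤ × ℤ := (f.1.1, f.1.2)

theorem even_lowerLeft (f : Face k q) : Even ((lowerLeft f).1 + (lowerLeft f).2) := by
  have := f.2.2.2
  rw [lowerLeft, Int.even_iff]
  omega

section Lift

variable {f f' : Face k q}

/-- The hexagon of the plane lattice with the lower left corner `a` lies above the face `f`. A glide
reflection turns hexagons upside down, so that it acts on the lower left corners with a sum of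
second coordinates that is smaller by `1`. -/
def IsLift (f : Face k q) (a : ℤ × ℤ) : Prop :=
  ∃ m t, a = deck k q (glueSum k - 1) m t (lowerLeft f)

namespace IsLift

theorem even (hq : Even q) (h : IsLift f a) : Even (a.1 + a.2) := by
  obtain ⟨m, t, rfl⟩ := h
  exact (even_deck_glueSum_sub_one_iff hq).2 (even_lowerLeft f)

theorem eq (h : IsLift f a) (h' : IsLift f' a) : f = f' := by
  have := f.2
  have := f'.2
  have hk : 0 < k := by omega
  have hlt : |(lowerLeft f').1 - (lowerLeft f).1| < k := by
    rw [lowerLeft, lowerLeft, abs_lt]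
    omega
  obtain ⟨hfst, hsnd⟩ := (proj_eq_proj_iff_of_abs_lt hlt).1
    (((proj_eq_proj_iff hk).2 h).trans ((proj_eq_proj_iff hk).2 h').symm)
  have hsnd := Int.eq_zero_of_abs_lt_dvd hsnd (by rw [lowerLeft, lowerLeft, abs_lt]; omega)
  simp only [lowerLeft] at hfst hsnd
  exact Subtype.ext (Prod.ext (by omega) (by omega))

end IsLift

theorem exists_isLift (hk : 0 < k) (hq : Even q) (hq0 : 0 < q) (ha : Even (a.1 + a.2)) :
    ∃ f : Face k q, IsLift f a := by
  obtain ⟨m, t, i, j, hi, hj, hij⟩ := exists_deck_eq_natCast hk hq0 (glueSum k - 1) a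
  have even_ij : Even ((i : ℤ) + j) := by
    have := (even_deck_glueSum_sub_one_iff (k := k) (m := m) (t := t) hq).2 ha
    rwa [hij] at this
  rw [Int.even_iff] at even_ij
  refine ⟨⟨(i, j), hi, hj, by simp only; omega⟩, (proj_eq_proj_iff hk).1 ?_⟩
  rw [lowerLeft, ← hij, proj_deck hk]

theorem faceBd_eq_cycleEdges (hk : 2 ≤ k) (f : Face k q) :
    faceBd k q f = cycleEdges (hexagon k q (lowerLeft f)) := by
  have := f.2.1
  have corner_eq (r : ZMod 6) (x y : ℕ) (hx : x ≤ 2) (hr : offset r = (↑x, ↑y)) :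
      pt k q (f.1.1 + x, f.1.2 + y) = hexagon k q (lowerLeft f) r := by
    rw [pt_eq_vert (by omega), hexagon, hr, lowerLeft]
    push_cast
    rfl
  simp only [faceBd]
  rw [corner_eq 0 0 0 (by norm_num) rfl, corner_eq 1 1 0 (by norm_num) rfl,
    corner_eq 2 2 0 le_rfl rfl, corner_eq 3 2 1 le_rfl rfl, corner_eq 4 1 1 (by norm_num) rfl,
    corner_eq 5 0 1 (by norm_num) rfl]
  ext e
  constructor
  · rintro (h | h | h | h | h | h)
    exacts [⟨0, h.symm⟩, ⟨1, h.symm⟩, ⟨2, h.symm⟩, ⟨3, h.symm⟩, ⟨4, h.symm⟩, ⟨5, h.symm⟩]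
  · rintro ⟨r, rfl⟩
    fin_cases r
    exacts [.inl rfl, .inr (.inl rfl), .inr (.inr (.inl rfl)), .inr (.inr (.inr (.inl rfl))),
      .inr (.inr (.inr (.inr (.inl rfl)))), .inr (.inr (.inr (.inr (.inr rfl))))]

/-- The positive edges on the boundary of a face: the lower left, the right and the upper left one
of a hexagon of the plane lattice. -/
def posBd (k q : ℕ) (f : Face k q) : Set (Sym2 (Vert k q)) :=
  alternateEdges (hexagon k q (lowerLeft f))

theorem IsLift.faceBd_eq (hk : 2 ≤ k) (h : IsLift f a) :
    faceBd k q f = cycleEdges (hexagon k q a) := by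
  obtain ⟨m, t, rfl⟩ := h
  rw [faceBd_eq_cycleEdges hk, hexagon_deck (by omega)]
  split_ifs
  · rfl
  · rw [cycleEdges_comp_sub]

theorem IsLift.posBd_eq (hk : 0 < k) (h : IsLift f a) :
    posBd k q f = alternateEdges (hexagon k q a) := by
  obtain ⟨m, t, rfl⟩ := h
  rw [posBd, hexagon_deck hk]
  split_ifs
  · rfl
  · exact (alternateEdges_comp_sub _ 2).symm

theorem exists_isLift_of_touches (hk : 2 ≤ k) (h : Touches (faceBd k q) (vert k q p) f) :
    ∃ a r, IsLift f a ∧ p = a + offset r := by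
  obtain ⟨e, he, hpe⟩ := h
  rw [faceBd_eq_cycleEdges hk] at he
  obtain ⟨r, hr⟩ := exists_eq_of_mem_cycleEdges he hpe
  obtain ⟨m, t, rfl⟩ := (proj_eq_proj_iff (by omega)).1 hr
  exact ⟨_, _, ⟨m, t, rfl⟩, deck_add_offset r⟩

end Lift

theorem exists_even_vert_eq (hk : 0 < k) (hq : Even q) (hq0 : 0 < q) (v : Vert k q) :
    ∃ p : ℤ × ℤ, Even (p.1 + p.2) ∧ vert k q p = v := by
  have : NeZero k := ⟨hk.ne'⟩
  have : NeZero q := ⟨hq0.ne'⟩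
  obtain ⟨p, rfl⟩ := vert_surjective v
  by_cases hp : Even (p.1 + p.2)
  · exact ⟨p, hp, rfl⟩
  · exact ⟨deck k q (glueSum k) 1 0 p, by simp [even_deck_glueSum_iff hq, hp], vert_deck hk⟩

/-- The steps from a point of the plane lattice with an even sum of coordinates to its neighbours:
to the left, to the right and upwards. -/
def step : Fin 3 → ℤ × ℤ := ![(-1, 0), (1, 0), (0, 1)]

theorem brickWall_adj_iff_of_even (hp : Even (p.1 + p.2)) {r : ℤ × ℤ} :
    brickWall.Adj p r ↔ ∃ l, r = p + step l := by
  have exists_step_iff : (∃ l, r = p + step l) ↔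
      r = p + (-1, 0) ∨ r = p + (1, 0) ∨ r = p + (0, 1) := by
    simp [Fin.exists_fin_succ, step]
  rw [exists_step_iff, brickWall_adj]
  simp only [Prod.ext_iff, Prod.fst_add, Prod.snd_add, Int.even_iff] at hp ⊢
  omega

/-- The lower left corner of the hexagon of the plane lattice at the point `p` that is opposite to
the edge from `p` to `p + step m`, if the sum of the coordinates of `p` is even. -/
def hexagonAt (p : ℤ × ℤ) (m : Fin 3) : ℤ × ℤ := p - offset (2 * m.val)

theorem even_hexagonAt (hp : Even (p.1 + p.2)) (m : Fin 3) :
    Even ((hexagonAt p m).1 + (hexagonAt p m).2) := by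
  have even_offset : Even ((offset (2 * m.val)).1 + (offset (2 * m.val)).2) := by decide +revert
  rw [hexagonAt, Prod.fst_sub, Prod.snd_sub, sub_add_sub_comm]
  exact hp.sub even_offset

theorem hexagon_hexagonAt (p : ℤ × ℤ) (m : Fin 3) :
    hexagon k q (hexagonAt p m) (2 * m.val) = vert k q p := by
  rw [hexagon, hexagonAt, sub_add_cancel]

theorem hexagon_hexagonAt_add_one (p : ℤ × ℤ) (m : Fin 3) :
    hexagon k q (hexagonAt p m) (2 * m.val + 1) = vert k q (p + step (m + 1)) := by
  have offset_eq : offset (2 * m.val + 1) = offset (2 * m.val) + step (m + 1) := by decide +revert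
  rw [hexagon, hexagonAt, offset_eq, ← add_assoc, sub_add_cancel]

theorem hexagon_hexagonAt_sub_one (p : ℤ × ℤ) (m : Fin 3) :
    hexagon k q (hexagonAt p m) (2 * m.val - 1) = vert k q (p + step (m + 2)) := by
  have offset_eq : offset (2 * m.val - 1) = offset (2 * m.val) + step (m + 2) := by decide +revert
  rw [hexagon, hexagonAt, offset_eq, ← add_assoc, sub_add_cancel]

theorem exists_isLift_hexagonAt_of_touches (hk : 2 ≤ k) (hq : Even q) (hp : Even (p.1 + p.2))
    {f : Face k q} (h : Touches (faceBd k q) (vert k q p) f) : ∃ m, IsLift f (hexagonAt p m) := by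
  obtain ⟨a, r, ha, rfl⟩ := exists_isLift_of_touches hk h
  have even_corner (r : ZMod 6) (hr : Even ((offset r).1 + (offset r).2)) :
      ∃ m : Fin 3, r = 2 * m.val := by decide +revert
  rw [Prod.fst_add, Prod.snd_add, add_add_add_comm, Int.even_add] at hp
  obtain ⟨m, hm⟩ := even_corner r (hp.1 (ha.even hq))
  exact ⟨m, by rwa [hexagonAt, ← hm, add_sub_cancel_right]⟩

theorem vert_add_step_injective (hk : 3 ≤ k) (p : ℤ × ℤ) :
    Function.Injective fun l => vert k q (p + step l) := by
  intro l l' h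
  have width : ∀ l l' : Fin 3, |(step l').1 - (step l).1| ≤ 2 := by decide
  have step_fst_injective : ∀ l l' : Fin 3, (step l').1 = (step l).1 → l = l' := by decide
  have hlt : |(p + step l').1 - (p + step l).1| < k := by
    rw [Prod.fst_add, Prod.fst_add, add_sub_add_left_eq_sub]
    exact (width l l').trans_lt (by omega)
  exact step_fst_injective l l' (add_left_cancel ((proj_eq_proj_iff_of_abs_lt hlt).1 h).1)

theorem exists_alternatingAt (hk : 3 ≤ k) (hq : Even q) (hq0 : 0 < q) (v : Vert k q) :
    ∃ nb fc, AlternatingAt (graph k q) (faceBd k q) (posBd k q) v nb fc := by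
  obtain ⟨p, hp, rfl⟩ := exists_even_vert_eq (by omega) hq hq0 v
  choose fc hfc using fun m => exists_isLift (k := k) (by omega) hq hq0 (even_hexagonAt hp m)
  have nb_injective := vert_add_step_injective (q := q) hk p
  refine ⟨fun l => vert k q (p + step l), fc, nb_injective, fun u => ?_, fun f hf => ?_,
    fun l m => ?_, fun l m => ?_⟩
  · rw [graph_adj_vert_iff (by omega) hq hq0]
    simp only [brickWall_adj_iff_of_even hp]
    constructor
    · rintro ⟨r, ⟨l, rfl⟩, rfl⟩
      exact ⟨l, rfl⟩
    · rintro ⟨l, rfl⟩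
      exact ⟨_, ⟨l, rfl⟩, rfl⟩
  · obtain ⟨m, hm⟩ := exists_isLift_hexagonAt_of_touches (by omega) hq hp hf
    exact ⟨m, hm.eq (hfc m)⟩
  · have ne_iff : l ≠ m ↔ l = m + 1 ∨ l = m + 2 := by
      clear hfc nb_injective
      decide +revert
    rw [(hfc m).faceBd_eq (by omega), ← hexagon_hexagonAt p m,
      mk_mem_cycleEdges_iff (hexagon_injective hk hq _), hexagon_hexagonAt_add_one,
      hexagon_hexagonAt_sub_one, ne_iff]
    exact or_congr nb_injective.eq_iff nb_injective.eq_iff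
  · rw [(hfc m).posBd_eq (by omega), ← hexagon_hexagonAt p m,
      mk_mem_alternateEdges_iff (by decide) (hexagon_injective hk hq _), hexagon_hexagonAt_add_one]
    exact nb_injective.eq_iff

theorem isAlternating (hk : 3 ≤ k) (hq : Even q) (hq0 : 0 < q) :
    IsAlternating (graph k q) (faceBd k q) (posBd k q) where
  subset_edgeSet f := by
    rw [faceBd_eq_cycleEdges (by omega)]
    rintro e ⟨r, rfl⟩
    exact (isEmbeddedCycle_hexagon hk hq hq0 (even_lowerLeft f)).adj r
  exists_alternatingAt := exists_alternatingAt hk hq hq0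

/-- Along each column of the lattice, every second point is a lower left corner of a hexagon. -/
def faceEquiv (hq : Even q) : Face k q ≃ Fin k × Fin (q / 2) where
  toFun f := ⟨⟨f.1.1, f.2.1⟩, ⟨f.1.2 / 2, by have := f.2.2.1; have := hq.two_dvd; omega⟩⟩
  invFun x := ⟨(x.1, 2 * x.2 + x.1 % 2), x.1.2, by have := x.2.2; dsimp only; omega,
    by dsimp only; omega⟩
  left_inv f := by
    have := f.2.2.2
    refine Subtype.ext (Prod.ext rfl ?_)
    dsimp only
    omega
  right_inv x := by
    refine Prod.ext rfl (Fin.ext ?_)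
    dsimp only
    omega

theorem isStrongEmbedding (hk : 3 ≤ k) (hq : Even q) (hq0 : 0 < q) :
    IsStrongEmbedding (graph k q) (faceBd k q) where
  finite_vert := by
    have : NeZero k := ⟨by omega⟩
    have : NeZero q := ⟨hq0.ne'⟩
    infer_instance
  finite_face := .of_equiv _ (faceEquiv hq).symm
  connected := graph_connected (by omega) hq hq0
  facial f := by
    obtain ⟨w, hw, edges_eq⟩ :=
      (isEmbeddedCycle_hexagon hk hq hq0 (even_lowerLeft f)).exists_isCycle_edges_eq
    exact ⟨_, w, hw, by rwa [faceBd_eq_cycleEdges (by omega)]⟩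
  two_faces := (isAlternating hk hq hq0).ncard_faces_eq_two
  link_connected := (isAlternating hk hq hq0).link_connected

theorem eulerChar_eq_zero (hk : 3 ≤ k) (hq : Even q) (hq0 : 0 < q) :
    eulerChar (graph k q) (Face k q) = 0 := by
  have : NeZero k := ⟨by omega⟩
  have : NeZero q := ⟨hq0.ne'⟩
  have card_edge := (isAlternating hk hq hq0).two_mul_card_edgeSet
  have card_vert : Nat.card (Vert k q) = k * q := by
    rw [Nat.card_prod, Nat.card_zmod, Nat.card_zmod]
  have card_face : 2 * Nat.card (Face k q) = k * q := by
    rw [Nat.card_congr (faceEquiv hq), Nat.card_prod, Nat.card_fin, Nat.card_fin,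
      Nat.mul_left_comm, Nat.mul_div_cancel' hq.two_dvd]
  rw [eulerChar]
  omega

theorem isKleinBottleEmbedding (hk : 3 ≤ k) (hq : Even q) (hq0 : 0 < q) :
    IsKleinBottleEmbedding (graph k q) (faceBd k q) where
  strong := isStrongEmbedding hk hq hq0
  nonorientable ho := not_colorable_two (by omega) hq hq0
    ((isAlternating hk hq hq0).colorable_two_of_orientable ho)
  euler := eulerChar_eq_zero hk hq hq0

end Ko

theorem lemma4p9_general (k q : ℕ) (hk : 3 ≤ k) (hq : Even q) (hq0 : 0 < q) :
    SurfaceMap.IsKleinBottleEmbedding (Ko.graph k q) (Ko.faceBd k q) ∧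
      ∀ (v : Ko.Vert k q) (w : (Ko.graph k q).Walk v v), w.IsCycle →
        (Odd w.length ↔ SurfaceMap.OneSided (Ko.faceBd k q) {e | e ∈ w.edges}) :=
  ⟨Ko.isKleinBottleEmbedding hk hq hq0,
    fun _ _ hw => (Ko.isAlternating hk hq hq0).odd_length_iff_oneSided hw⟩

theorem lemma4p9 (k q : ℕ) (hk : 3 ≤ k) (hq : Even q) (hq0 : 0 < q) :
    SurfaceMap.IsCrossCapOdd (Ko.graph k q) (Ko.faceBd k q) :=
  (lemma4p9_general k q hk hq hq0).imp_right fun h v w hw _ => h v w hw
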